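/- Let $3\le r\le 8$ and let $S_r$ be a del Pezzo surface obtained by blowing up $\mathbb{P}^2$ at $r$ points in general position, so that $\operatorname{Pic}S_r=\mathbb{Z}h\oplus\mathbb{Z}e_1\oplus\dots\oplus\mathbb{Z}e_r$ with intersection form $h^2=1$, $h\cdot e_i=0$, $e_i\cdot e_j=-\delta_{ij}$, and canonical class $K=-3h+\sum_{i=1}^r e_i$. A *line* is a class $l\in\operatorname{Pic}S_r$ with $l^2=l\cdot K=-1$. The Gosset polytope $(r-4)_{21}$ is the convex hull of the lines in $\operatorname{Pic}S_r\otimes\mathbb{Q}$; it lies in the affine hyperplane $\{D : -D\cdot K=1\}$, on which the negative of the intersection form is a Euclidean metric. An $(r-1)$-crosspolytope in $(r-4)_{21}$ is a face of $(r-4)_{21}$ that is an $(r-1)$-dimensional regular crosspolytope for this metric, that is, the convex hull of $2(r-1)$ points $c\pm v_1,\dots,c\pm v_{r-1}$, where $v_1,\dots,v_{r-1}$ are pairwise orthogonal vectors of the same positive length. Its *center* is normalized to be the sum $2c$ of any two antipodal vertices. Put $$B_r:=\{\,l_1+l_2 \;:\; l_1,l_2\in\operatorname{Pic}S_r\text{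 lines with } l_1\cdot l_2=1\,\}.$$ Then $B_r$, viewed in $\operatorname{Pic}S_r\otimes\mathbb{Q}$, is exactly the set of centers of the $(r-1)$-crosspolytopes in $(r-4)_{21}$. Moreover each element of $B_r$ is the center of exactly one $(r-1)$-crosspolytope in $(r-4)_{21}$, and the center of an $(r-1)$-crosspolytope is uniquely determined, so that taking centers is a bijection from the set of $(r-1)$-crosspolytopes in $(r-4)_{21}$ onto $B_r$. -/

import Mathlib

namespace DelPezzo

/-- The free `R`-module `R h ⊕ R e₁ ⊕ ⋯ ⊕ R e_r`; the pair `(a, b)` stands for `a h + ∑ bᵢ eᵢ`. -/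
abbrev PicWith (R : Type) (r : ℕ) : Type := R × (Fin r → R)

/-- The Picard group `Pic S_r = ℤ h ⊕ ℤ e₁ ⊕ ⋯ ⊕ ℤ e_r` of a del Pezzo surface `S_r`, the blow-up
of the projective plane in `r` points in general position: `h` is the pull-back of the class of a
line in the plane and `eᵢ` is the class of the `i`-th exceptional curve. -/
abbrev Pic (r : ℕ) : Type := PicWith ℤ r

/-- The rational vector space `Pic S_r ⊗ ℚ = ℚ h ⊕ ℚ e₁ ⊕ ⋯ ⊕ ℚ e_r`. -/
abbrev PicQ (r : ℕ) : Type := PicWith ℚ r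

section Form

variable {R : Type} [CommRing R] {r : ℕ}

/-- The class `h`. -/
def hClass : PicWith R r := (1, 0)

/-- The class `eᵢ`. -/
def eClass (i : Fin r) : PicWith R r := (0, Pi.single i 1)

/-- The intersection form, of signature `(1, -r)`. -/
def inter (D E : PicWith R r) : R := D.1 * E.1 - ∑ i, D.2 i * E.2 i

/-- The canonical class `K = -3h + e₁ + ⋯ + e_r`. -/
def canonical : PicWith R r := (-3 : R) • hClass + ∑ i, eClass i

theorem inter_hClass_hClass : inter (hClass : PicWith R r) hClass = 1 := by
  simp [inter, hClass]

theorem inter_hClass_eClass (i : Fin r) : inter (hClass : PicWith R r) (eClass i) = 0 := by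
  simp [inter, hClass, eClass]

theorem inter_eClass_eClass (i j : Fin r) :
    inter (eClass i : PicWith R r) (eClass j) = if i = j then -1 else 0 := by
  by_cases h : i = j
  · subst h
    simp [inter, eClass, Pi.single_apply]
  · have h' : j ≠ i := fun hji => h hji.symm
    simp [inter, eClass, Pi.single_apply, h, h']

end Form

/-- The inclusion of `Pic S_r` in `Pic S_r ⊗ ℚ`. -/
def toQ {r : ℕ} (D : Pic r) : PicQ r := ((D.1 : ℚ), fun i => (D.2 i : ℚ))

/-- The set `L_r` of lines: the classes `l` with `l² = l · K = -1`. -/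
def lines (r : ℕ) : Set (Pic r) :=
  {l | inter l l = -1 ∧ inter l canonical = -1}

/-- The set `B_r` of the classes `l₁ + l₂`, where `l₁`, `l₂` are lines with `l₁ · l₂ = 1`. -/
def linePairSums (r : ℕ) : Set (Pic r) :=
  {D | ∃ l₁ ∈ lines r, ∃ l₂ ∈ lines r, inter l₁ l₂ = 1 ∧ D = l₁ + l₂}

/-- The affine hyperplane section `-D · K = b` of `Pic S_r ⊗ ℚ`. For `r ≤ 8` the intersection form
is negative definite on the directions of this hyperplane, i.e. on the section with `b = 0`; its
negative makes the hyperplane a Euclidean affine space. -/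
def hyperplane (r : ℕ) (b : ℚ) : Set (PicQ r) := {D | -inter D canonical = b}

/-- The Gosset polytope `(r - 4)₂₁` in `Pic S_r ⊗ ℚ`: the convex hull of the lines. -/
def gossetPolytope (r : ℕ) : Set (PicQ r) := convexHull ℚ (toQ '' lines r)

/-- `F` is an `n`-dimensional crosspolytope with centre of symmetry `c` in the section `-D · K = 1`:
its `2n` vertices `c ± vᵢ` are the points in which the lines through `c` spanned by `n` pairwise
orthogonal directions meet a sphere centred at `c`. The Euclidean structure is the negative of
the intersection form, so `ρ` is the square of the radius of that sphere. -/
def IsCrosspolytopeAt (r n : ℕ) (c : PicQ r) (F : Set (PicQ r)) : Prop :=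
  c ∈ hyperplane r 1 ∧
    ∃ (v : Fin n → PicQ r) (ρ : ℚ), 0 < ρ ∧
      (∀ i, v i ∈ hyperplane r 0) ∧
      (∀ i j, -inter (v i) (v j) = if i = j then ρ else 0) ∧
      F = convexHull ℚ (Set.range (fun i => c + v i) ∪ Set.range (fun i => c - v i))

/-- `F` is an `(r - 1)`-crosspolytope in the Gosset polytope, i.e. a face of it that is an
`(r - 1)`-dimensional crosspolytope, and `D` is its centre, in the normalization in which the
centre is the sum of any two antipodal vertices (that is, twice the centre of symmetry). -/
def IsCrosspolytopeWithCenter (r : ℕ) (F : Set (PicQ r)) (D : PicQ r) : Prop :=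
  IsExposed ℚ (gossetPolytope r) F ∧
    ∃ c : PicQ r, IsCrosspolytopeAt r (r - 1) c F ∧ D = (2 : ℚ) • c

end DelPezzo

/-! Everything goes through conic classes, `D² = 0` and `D · K = -2`; every element of `B_r` is one.
The form is negative definite on `K^⊥` for `r ≤ 8`, so a conic class is nonnegative on lines, and
the lines orthogonal to it span an exposed face, `conicFace D`. Reflections in roots `h - eᵢ - eⱼ -
e_k` lower the degree of `D` (Noether's inequality) until `D = h - eᵢ`, where the other `eⱼ` are `r
- 1` disjoint lines orthogonal to `D`. With their mirror images `D - l` they exhaust the lines of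
the face, by a rank count (`eq_or_eq_sub_of_inter_eq_zero`), so the face is a crosspolytope centred
at `D / 2`.

Conversely, the vertices of a crosspolytope face are lines. If `p`, `q` are antipodal and `D = p +
q`, orthogonality of the axes makes `D²` a multiple of 4, while `0 ≤ p · q ≤ 3` bounds `D² = 2 p · q
- 2`. Only 0 and 4 remain, and 4 would put the centre at `-K` with `r = 8`, forcing all lines into
the face. Hence `D` is conic and the face is `conicFace D`, which in turn determines `D`. -/

namespace DelPezzo

section Form

variable {R : Type} [CommRing R] {r : ℕ}

theorem inter_comm (x y : PicWith R r) : inter x y = inter y x := by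
  simp [inter, mul_comm]

theorem inter_add_left (x y z : PicWith R r) : inter (x + y) z = inter x z + inter y z := by
  simp only [inter, Prod.fst_add, Prod.snd_add, Pi.add_apply, add_mul, Finset.sum_add_distrib]
  ring

theorem inter_smul_left (a : R) (x y : PicWith R r) : inter (a • x) y = a * inter x y := by
  simp only [inter, Prod.smul_fst, Prod.smul_snd, Pi.smul_apply, smul_eq_mul, mul_assoc,
    ← Finset.mul_sum]
  ring

theorem inter_add_right (x y z : PicWith R r) : inter x (y + z) = inter x y + inter x z := by
  rw [inter_comm, inter_add_left, inter_comm y, inter_comm z]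

theorem inter_smul_right (a : R) (x y : PicWith R r) : inter x (a • y) = a * inter x y := by
  rw [inter_comm, inter_smul_left, inter_comm y]

theorem inter_sub_left (x y z : PicWith R r) : inter (x - y) z = inter x z - inter y z := by
  have h : x - y = x + (-1 : R) • y := by rw [neg_one_smul, sub_eq_add_neg]
  rw [h, inter_add_left, inter_smul_left]
  ring

theorem inter_sub_right (x y z : PicWith R r) : inter x (y - z) = inter x y - inter x z := by
  rw [inter_comm, inter_sub_left, inter_comm y, inter_comm z]

/-- The functional `x ↦ x · y`. -/
def interRight (y : PicWith R r) : PicWith R r →ₗ[R] R where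
  toFun x := inter x y
  map_add' x z := inter_add_left x z y
  map_smul' a x := inter_smul_left a x y

@[simp]
theorem interRight_apply (x y : PicWith R r) : interRight y x = inter x y := rfl

theorem canonical_fst : (canonical : PicWith R r).1 = -3 := by
  simp [canonical, hClass, eClass, Prod.fst_sum]

theorem canonical_snd (i : Fin r) : (canonical : PicWith R r).2 i = 1 := by
  simp [canonical, hClass, eClass, Prod.snd_sum, Finset.sum_apply, Pi.single_apply]

theorem inter_canonical (x : PicWith R r) :
    inter x canonical = -3 * x.1 - ∑ i, x.2 i := by
  simp [inter, canonical_fst, canonical_snd, mul_comm]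

theorem inter_canonical_canonical : inter (canonical : PicWith R r) canonical = 9 - r := by
  simp [inter_canonical, canonical_fst, canonical_snd]
  norm_num

theorem inter_hClass (x : PicWith R r) : inter x hClass = x.1 := by
  simp [inter, hClass]

theorem inter_eClass (x : PicWith R r) (i : Fin r) : inter x (eClass i) = -x.2 i := by
  simp [inter, eClass, Pi.single_apply]

/-- Pairwise orthogonal anisotropic vectors are at most `r + 1` in number. -/
theorem card_le_of_orthogonal [IsDomain R] {ι : Type} [Fintype ι] (u : ι → PicWith R r)
    (h₀ : ∀ i, inter (u i) (u i) ≠ 0) (h : ∀ i j, i ≠ j → inter (u i) (u j) = 0) :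
    Fintype.card ι ≤ r + 1 := by
  have hli : LinearIndependent R u := by
    rw [Fintype.linearIndependent_iff]
    intro g hg j
    have h₁ := congrArg (interRight (u j)) hg
    rw [map_sum, map_zero, Finset.sum_eq_single j (fun i _ hij => by simp [h i j hij])
      (by simp)] at h₁
    simpa [h₀ j] using h₁
  have := hli.fintype_card_le_finrank
  simp at this
  omega

/-- The reflection in a class `α` with `α² = -2`. -/
def reflect (α x : PicWith R r) : PicWith R r := x + inter x α • α

theorem inter_reflect_left (α x y : PicWith R r) :
    inter (reflect α x) y = inter x (reflect α y) := by
  simp only [reflect, inter_add_left, inter_add_right, inter_smul_left, inter_smul_right,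
    inter_comm y α]
  ring

theorem reflect_reflect {α : PicWith R r} (hα : inter α α = -2) (x : PicWith R r) :
    reflect α (reflect α x) = x := by
  simp only [reflect, inter_add_left, inter_smul_left, hα]
  module

theorem inter_reflect_reflect {α : PicWith R r} (hα : inter α α = -2) (x y : PicWith R r) :
    inter (reflect α x) (reflect α y) = inter x y := by
  rw [inter_reflect_left, reflect_reflect hα]

theorem inter_reflect_canonical {α : PicWith R r} (hα : inter α canonical = 0)
    (x : PicWith R r) : inter (reflect α x) canonical = inter x canonical := by
  simp [reflect, inter_add_left, inter_smul_left, hα]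

end Form

/-! ### Negative definiteness on the orthogonal complement of `K` -/

section Definite

variable {R : Type} [CommRing R] [LinearOrder R] [IsStrictOrderedRing R] {r : ℕ}

/-- Cauchy–Schwarz with `∑ bᵢ = -3a` gives `9a² ≤ r ∑ bᵢ² ≤ 8 ∑ bᵢ²`. The leftover `-a²` is what
yields definiteness and not just semidefiniteness. -/
theorem inter_self_bound (hr : r ≤ 8) {x : PicWith R r} (hx : inter x canonical = 0) :
    8 * inter x x ≤ - x.1 ^ 2 := by
  have hcs : (∑ i, x.2 i) ^ 2 ≤ r * ∑ i, x.2 i ^ 2 := by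
    simpa using sq_sum_le_card_mul_sum_sq (s := Finset.univ) (f := x.2)
  have h₀ : 0 ≤ ∑ i, x.2 i ^ 2 := Finset.sum_nonneg fun i _ => sq_nonneg _
  have hr' : (r : R) ≤ 8 := by exact_mod_cast hr
  have h₁ := mul_le_mul_of_nonneg_right hr' h₀
  rw [inter_canonical] at hx
  have h₂ : ∑ i, x.2 i = -3 * x.1 := by linear_combination -hx
  rw [h₂] at hcs
  have h₃ : inter x x = x.1 ^ 2 - ∑ i, x.2 i ^ 2 := by simp [inter, sq]
  rw [h₃]
  linarith

theorem inter_self_nonpos (hr : r ≤ 8) {x : PicWith R r} (hx : inter x canonical = 0) :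
    inter x x ≤ 0 := by
  have := inter_self_bound hr hx
  have := sq_nonneg x.1
  linarith

theorem eq_zero_of_inter_self (hr : r ≤ 8) {x : PicWith R r} (hx : inter x canonical = 0)
    (hxx : inter x x = 0) : x = 0 := by
  have h := inter_self_bound hr hx
  have h₁ : x.1 = 0 := by
    have : x.1 ^ 2 = 0 := le_antisymm (by rw [hxx] at h; linarith) (sq_nonneg _)
    simpa using this
  have h₂ : ∑ i, x.2 i * x.2 i = 0 := by
    rw [inter, h₁] at hxx
    linear_combination -hxx
  rw [Finset.sum_eq_zero_iff_of_nonneg fun i _ => mul_self_nonneg _] at h₂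
  ext i
  · simpa using h₁
  · simpa using h₂ i (Finset.mem_univ i)

end Definite

/-! ### Lines and conic classes -/

section Conic

variable {r : ℕ}

/-- The classes `D` with `D² = 0` and `D · K = -2`. -/
def IsConicClass (D : Pic r) : Prop := inter D D = 0 ∧ inter D canonical = -2

theorem isConicClass_of_mem_linePairSums {D : Pic r} (hD : D ∈ linePairSums r) :
    IsConicClass D := by
  obtain ⟨l, ⟨hl, hlK⟩, m, ⟨hm, hmK⟩, hlm, rfl⟩ := hD
  simp only [IsConicClass, inter_add_left, inter_add_right, inter_comm m l]
  omega

theorem eClass_mem_lines (i : Fin r) : eClass i ∈ lines r := by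
  constructor
  · simp [inter_eClass_eClass]
  · simp [inter_comm _ canonical, inter_eClass, canonical_snd]

theorem IsConicClass.sub_mem_lines {D l : Pic r} (hD : IsConicClass D) (hl : l ∈ lines r)
    (h : inter l D = 0) : D - l ∈ lines r := by
  obtain ⟨hDD, hDK⟩ := hD
  obtain ⟨hll, hlK⟩ := hl
  constructor <;> simp only [inter_sub_left, inter_sub_right, inter_comm D l] <;> omega

/-- The nonzero vector `l - m` of `K^⊥` has square `-2 - 2 l · m`, which must be negative. -/
theorem inter_lines_nonneg (hr : r ≤ 8) {l m : Pic r} (hl : l ∈ lines r) (hm : m ∈ lines r)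
    (h : l ≠ m) : 0 ≤ inter l m := by
  obtain ⟨hll, hlK⟩ := hl
  obtain ⟨hmm, hmK⟩ := hm
  have hK : inter (l - m) canonical = 0 := by rw [inter_sub_left]; omega
  have h₁ := inter_self_nonpos hr hK
  have h₂ : inter (l - m) (l - m) = -2 - 2 * inter l m := by
    simp only [inter_sub_left, inter_sub_right, inter_comm m l, hll, hmm]
    ring
  have h₃ : inter (l - m) (l - m) ≠ 0 := fun h0 =>
    h (sub_eq_zero.1 (eq_zero_of_inter_self hr hK h0))
  omega

/-- Definiteness is applied to `2l - D`, which lies in `K^⊥` and is nonzero because `(2l)² = -4`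
while `D² = 0`. -/
theorem IsConicClass.inter_line_nonneg (hr : r ≤ 8) {D l : Pic r} (hD : IsConicClass D)
    (hl : l ∈ lines r) : 0 ≤ inter l D := by
  obtain ⟨hDD, hDK⟩ := hD
  obtain ⟨hll, hlK⟩ := hl
  have hK : inter ((2 : ℤ) • l - D) canonical = 0 := by
    rw [inter_sub_left, inter_smul_left]; omega
  have h₁ := inter_self_nonpos hr hK
  have h₂ : inter ((2 : ℤ) • l - D) ((2 : ℤ) • l - D) = -4 - 4 * inter l D := by
    simp only [inter_sub_left, inter_sub_right, inter_smul_left, inter_smul_right,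
      inter_comm D l, hll, hDD]
    ring
  have h₃ : inter ((2 : ℤ) • l - D) ((2 : ℤ) • l - D) ≠ 0 := by
    intro h0
    have := sub_eq_zero.1 (eq_zero_of_inter_self hr hK h0)
    rw [← this] at hDD
    simp only [inter_smul_left, inter_smul_right] at hDD
    omega
  omega

theorem IsConicClass.fst_pos (hr : r ≤ 8) {D : Pic r} (hD : IsConicClass D) : 0 < D.1 := by
  obtain ⟨hDD, hDK⟩ := hD
  have hhK : inter (hClass : Pic r) canonical = -3 := by
    rw [inter_comm, inter_hClass, canonical_fst]
  have hK : inter ((3 : ℤ) • D - (2 : ℤ) • hClass) canonical = 0 := by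
    rw [inter_sub_left, inter_smul_left, inter_smul_left]; omega
  have h₁ := inter_self_nonpos hr hK
  simp only [inter_sub_left, inter_sub_right, inter_smul_left, inter_smul_right,
      inter_comm hClass D, inter_hClass_hClass, hDD] at h₁
  rw [inter_hClass] at h₁
  omega

theorem IsConicClass.reflect {α D : Pic r} (hα : inter α α = -2) (hαK : inter α canonical = 0)
    (hD : IsConicClass D) : IsConicClass (reflect α D) := by
  rw [IsConicClass, inter_reflect_reflect hα, inter_reflect_canonical hαK]
  exact hD

theorem reflect_mem_lines {α l : Pic r} (hα : inter α α = -2) (hαK : inter α canonical = 0)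
    (hl : l ∈ lines r) : DelPezzo.reflect α l ∈ lines r := by
  rw [lines, Set.mem_ofPred_eq, inter_reflect_reflect hα, inter_reflect_canonical hαK]
  exact hl

/-- Here `a ≥ b ≥ c` are the three largest multiplicities, `S` and `Q` the sum and square sum of the
others. If `a + b + c ≤ d` and `c > 0`, then `d² - 3cd + 2c ≤ a(a - c) + b(b - c)`; by convexity the
right side is at most `(d - 2c)(d - 3c)`, so `d + 1 ≤ 3c`, against `3c ≤ d`. -/
theorem noether_arith {d a b c S Q : ℤ} (hd : 1 < d) (hc : 0 ≤ c) (hcb : c ≤ b) (hba : b ≤ a)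
    (hS : a + b + c + S = 3 * d - 2) (hQ : a ^ 2 + b ^ 2 + c ^ 2 + Q = d ^ 2) (hQS : Q ≤ c * S)
    (hS₀ : c = 0 → S ≤ 0) :
    d < a + b + c := by
  by_contra! h
  rcases hc.eq_or_lt with rfl | hc
  · have := hS₀ rfl
    omega
  · nlinarith [mul_nonneg (sub_nonneg.2 hcb) (sub_nonneg.2 hba), mul_pos hc (by omega : 0 < d),
      mul_nonneg (sub_nonneg.2 h) (sub_nonneg.2 hcb), mul_nonneg (sub_nonneg.2 h) hc.le,
      mul_nonneg (sub_nonneg.2 h) (sub_nonneg.2 hba), mul_nonneg (sub_nonneg.2 hcb) hc.le,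
      mul_nonneg (sub_nonneg.2 hba) hc.le, sq_nonneg (d - a - b - c), sq_nonneg (b - c)]

/-- Noether's inequality for the multiplicities `mᵢ` of a class with `D² = 0`, `D · K = -2`. -/
theorem exists_noether_triple (hr : 3 ≤ r) (m : Fin r → ℤ) (hm : ∀ i, 0 ≤ m i) {d : ℤ}
    (hd : 1 < d) (hS : ∑ i, m i = 3 * d - 2) (hQ : ∑ i, m i ^ 2 = d ^ 2) :
    ∃ i j k, i ≠ j ∧ i ≠ k ∧ j ≠ k ∧ d < m i + m j + m k := by
  obtain ⟨i, -, hi⟩ := Finset.exists_max_image (Finset.univ : Finset (Fin r)) m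
    (Finset.card_pos.1 (by simp; omega))
  obtain ⟨j, hj', hj⟩ := Finset.exists_max_image ((Finset.univ : Finset (Fin r)).erase i) m
    (Finset.card_pos.1 (by simp; omega))
  obtain ⟨k, hk', hk⟩ := Finset.exists_max_image
    (((Finset.univ : Finset (Fin r)).erase i).erase j) m
    (Finset.card_pos.1 (by rw [Finset.card_erase_of_mem hj']; simp; omega))
  have hji : j ≠ i := Finset.ne_of_mem_erase hj'
  have hkj : k ≠ j := Finset.ne_of_mem_erase hk'
  have hki : k ≠ i := Finset.ne_of_mem_erase (Finset.mem_of_mem_erase hk')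
  refine ⟨i, j, k, hji.symm, hki.symm, hkj.symm, ?_⟩
  have split (f : Fin r → ℤ) : ∑ l, f l = f i + f j + f k +
      ∑ l ∈ (((Finset.univ : Finset (Fin r)).erase i).erase j).erase k, f l := by
    rw [← Finset.add_sum_erase _ _ (Finset.mem_univ i), ← Finset.add_sum_erase _ _ hj',
      ← Finset.add_sum_erase _ _ hk']
    ring
  rw [split] at hS hQ
  refine noether_arith hd (hm k) (hj k (Finset.mem_of_mem_erase hk')) (hi j (Finset.mem_univ j))
    hS hQ ?_ fun h₀ => Finset.sum_nonpos fun l hl => h₀ ▸ hk l (Finset.mem_of_mem_erase hl)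
  rw [Finset.mul_sum]
  refine Finset.sum_le_sum fun l hl => ?_
  rw [sq]
  exact mul_le_mul_of_nonneg_right (hk l (Finset.mem_of_mem_erase hl)) (hm l)

/-- The multiplicities are nonnegative with sum 1, so `D = h - eᵢ`, and the lines are the `eⱼ` with
`j ≠ i`. -/
theorem exists_disjoint_lines_of_degree_one {D : Pic r} (hD : IsConicClass D)
    (hD₁ : D.1 = 1) (hD₂ : ∀ i, 0 ≤ -D.2 i) :
    ∃ l : Fin (r - 1) → Pic r, (∀ i, l i ∈ lines r) ∧ (∀ i, inter (l i) D = 0) ∧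
      ∀ i j, i ≠ j → inter (l i) (l j) = 0 := by
  obtain ⟨hDD, hDK⟩ := hD
  rw [inter_canonical, hD₁] at hDK
  have hS : ∑ i, -D.2 i = 1 := by rw [Finset.sum_neg_distrib]; omega
  obtain ⟨i, hi⟩ : ∃ i, 0 < -D.2 i := by
    by_contra! h
    have := Finset.sum_nonpos fun i (_ : i ∈ Finset.univ) => h i
    omega
  have h₀ : ∀ j ≠ i, D.2 j = 0 := by
    intro j hj
    rw [← Finset.add_sum_erase _ _ (Finset.mem_univ i)] at hS
    have h₁ := Finset.single_le_sum (fun k _ => hD₂ k)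
      (Finset.mem_erase.2 ⟨hj, Finset.mem_univ j⟩)
    have := hD₂ j
    omega
  let e : {j // j ≠ i} ≃ Fin (r - 1) := Fintype.equivFinOfCardEq (by
    rw [Fintype.card_subtype_compl, Fintype.card_fin, Fintype.card_subtype_eq])
  refine ⟨fun n => eClass (e.symm n).1, fun n => eClass_mem_lines _, fun n => ?_,
    fun n n' hn => ?_⟩
  · rw [inter_comm, inter_eClass, h₀ _ (e.symm n).2, neg_zero]
  · rw [inter_eClass_eClass, if_neg]
    exact fun h => hn (e.symm.injective (Subtype.ext h))

/-- A conic class has `r - 1` singular fibres, and one can choose disjoint components of them. -/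
theorem IsConicClass.exists_disjoint_lines (hr₃ : 3 ≤ r) (hr₈ : r ≤ 8) {D : Pic r}
    (hD : IsConicClass D) :
    ∃ l : Fin (r - 1) → Pic r, (∀ i, l i ∈ lines r) ∧ (∀ i, inter (l i) D = 0) ∧
      ∀ i j, i ≠ j → inter (l i) (l j) = 0 := by
  induction hn : D.1.toNat using Nat.strong_induction_on generalizing D with
  | _ n ih =>
  have hpos := hD.fst_pos hr₈
  have hm (i : Fin r) : 0 ≤ -D.2 i := by
    simpa [inter_comm _ D, inter_eClass] using hD.inter_line_nonneg hr₈ (eClass_mem_lines i)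
  rcases (show 1 ≤ D.1 by omega).eq_or_lt with h₁ | h₁
  · exact exists_disjoint_lines_of_degree_one hD h₁.symm hm
  obtain ⟨i, j, k, hij, hik, hjk, h⟩ := exists_noether_triple hr₃ (fun i => -D.2 i) hm h₁
    (by have := hD.2; rw [inter_canonical] at this; rw [Finset.sum_neg_distrib]; omega)
    (by have := hD.1; simp only [inter, ← sq] at this; simp only [neg_sq]; omega)
  -- Reflection in this root is the quadratic Cremona transformation; it adds `D · α = d - mᵢ - mⱼ -
  -- m_k < 0` to the degree.
  let α : Pic r := hClass - eClass i - eClass j - eClass k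
  have hα : inter α α = -2 := by
    simp [α, inter_sub_left, inter_sub_right, inter_eClass_eClass, inter_hClass_eClass,
      inter_hClass_hClass, inter_comm (eClass _) hClass, hij, hik, hjk, hij.symm, hik.symm,
      hjk.symm]
  have hαK : inter α canonical = 0 := by
    rw [inter_comm]
    simp [α, inter_sub_right, inter_eClass, inter_hClass, canonical_fst, canonical_snd]
  have hDα : inter D α = D.1 + D.2 i + D.2 j + D.2 k := by
    simp only [α, inter_sub_right, inter_eClass, inter_hClass]
    ring
  have hfst : (DelPezzo.reflect α D).1 = D.1 + (D.1 + D.2 i + D.2 j + D.2 k) := by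
    simp only [DelPezzo.reflect, hDα]
    simp [α, hClass, eClass]
  obtain ⟨l, hl, hlD, hll⟩ := ih _ (by rw [hfst, ← hn]; omega)
    (hD.reflect hα hαK) rfl
  exact ⟨fun n => DelPezzo.reflect α (l n), fun n => reflect_mem_lines hα hαK (hl n),
    fun n => by rw [inter_reflect_left, hlD], fun n n' hne => by
      rw [inter_reflect_reflect hα, hll n n' hne]⟩

theorem eq_or_eq_sub_of_inter_eq_zero (hr₃ : 3 ≤ r) (hr₈ : r ≤ 8) {D : Pic r}
    (hD : IsConicClass D) {l : Fin (r - 1) → Pic r} (hl : ∀ i, l i ∈ lines r)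
    (hlD : ∀ i, inter (l i) D = 0) (hll : ∀ i j, i ≠ j → inter (l i) (l j) = 0)
    {m : Pic r} (hm : m ∈ lines r) (hmD : inter m D = 0) : ∃ i, m = l i ∨ m = D - l i := by
  by_contra! hne
  -- Both `m · lᵢ` and `m · (D - lᵢ) = -m · lᵢ` are nonnegative.
  have hml (i : Fin (r - 1)) : inter (l i) m = 0 := by
    have h₁ := inter_lines_nonneg hr₈ hm (hl i) (hne i).1
    have h₂ := inter_lines_nonneg hr₈ hm (hD.sub_mem_lines (hl i) (hlD i)) (hne i).2
    rw [inter_sub_right] at h₂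
    rw [inter_comm]
    omega
  have hK := inter_canonical_canonical (R := ℤ) (r := r)
  -- These are `r + 2` orthogonal anisotropic vectors in rank `r + 1`. The second is `9 - r = K²`
  -- times the projection of `D` to `K^⊥`.
  let u : Option (Option (Option (Fin (r - 1)))) → Pic r
    | none => canonical
    | some none => (9 - r : ℤ) • D + (2 : ℤ) • canonical
    | some (some none) => (2 : ℤ) • m - D
    | some (some (some i)) => (2 : ℤ) • l i - D
  have hcard := card_le_of_orthogonal u (by
    rintro (_ | _ | _ | i) <;>
    simp only [u, inter_add_left, inter_add_right, inter_sub_left, inter_sub_right,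
      inter_smul_left, inter_smul_right, inter_comm canonical D, inter_comm D m,
      inter_comm D (l _), hK, hD.1, hD.2, hm.1, hmD, (hl _).1, hlD] <;>
    omega
    ) (by
    rintro (_ | _ | _ | i) (_ | _ | _ | j) hij <;>
    simp only [ne_eq, not_true_eq_false, Option.some.injEq] at hij <;>
    simp only [u, inter_add_left, inter_add_right, inter_sub_left, inter_sub_right,
      inter_smul_left, inter_smul_right, inter_comm canonical D, inter_comm D m,
      inter_comm canonical m, inter_comm canonical (l _), inter_comm m (l _), hml, hm.2, (hl _).2,
      inter_comm D (l _), hK, hD.1, hD.2, hmD, hlD] <;>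
    try rw [hll _ _ hij]
    all_goals ring)
  simp at hcard
  omega

end Conic

end DelPezzo

/-! ### Maximizing a linear functional over a convex hull -/

section ConvexHull

variable {E : Type} [AddCommGroup E] [Module ℚ E]

theorem mem_convexHull_sep_of_le (f : E →ₗ[ℚ] ℚ) {S : Set E} {M : ℚ} (hS : ∀ y ∈ S, f y ≤ M)
    {x : E} (hx : x ∈ convexHull ℚ S) : f x < M ∨ x ∈ convexHull ℚ {y ∈ S | f y = M} := by
  have heq : ∀ y ∈ convexHull ℚ {y ∈ S | f y = M}, f y = M := fun y hy =>
    convexHull_min (t := {y | f y = M}) (fun z hz => hz.2)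
      (convex_hyperplane f.isLinear M) hy
  refine convexHull_min (t := {x | f x < M ∨ x ∈ convexHull ℚ {y ∈ S | f y = M}})
    (fun y hy => ?_) ?_ hx
  · rcases (hS y hy).lt_or_eq with h | h
    · exact Or.inl h
    · exact Or.inr (subset_convexHull ℚ _ ⟨hy, h⟩)
  · rw [convex_iff_forall_pos]
    rintro y hy z hz a b ha hb hab
    have hlt {y z : E} {a b : ℚ} (ha : 0 < a) (hb : 0 < b) (hab : a + b = 1) (hy : f y < M)
        (hz : f z ≤ M) : f (a • y + b • z) < M := by
      simp only [map_add, map_smul, smul_eq_mul]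
      have h₁ := mul_lt_mul_of_pos_left hy ha
      have h₂ := mul_le_mul_of_nonneg_left hz hb.le
      have h₃ : a * M + b * M = M := by rw [← add_mul, hab, one_mul]
      linarith
    rcases hy with hy | hy
    · exact Or.inl (hlt ha hb hab hy (hz.elim le_of_lt fun h => (heq z h).le))
    · rcases hz with hz | hz
      · rw [add_comm]
        exact Or.inl (hlt hb ha (by rwa [add_comm]) hz (heq y hy).le)
      · exact Or.inr (convex_convexHull ℚ _ hy hz ha.le hb.le hab)

theorem le_of_mem_convexHull (f : E →ₗ[ℚ] ℚ) {S : Set E} {M : ℚ} (hS : ∀ y ∈ S, f y ≤ M)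
    {x : E} (hx : x ∈ convexHull ℚ S) : f x ≤ M :=
  convexHull_min (t := {y | f y ≤ M}) hS (convex_halfSpace_le f.isLinear M) hx

theorem mem_extremePoints_convexHull_of_forall_lt (f : E →ₗ[ℚ] ℚ) {S : Set E} {x : E}
    (hx : x ∈ S) (h : ∀ y ∈ S, y ≠ x → f y < f x) : x ∈ (convexHull ℚ S).extremePoints ℚ := by
  have hle : ∀ y ∈ S, f y ≤ f x := fun y hy => by
    by_cases hyx : y = x
    · rw [hyx]
    · exact (h y hy hyx).le
  have huniq : ∀ y ∈ convexHull ℚ S, f x ≤ f y → y = x := by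
    intro y hy hxy
    rcases mem_convexHull_sep_of_le f hle hy with hlt | hmem
    · exact absurd hxy hlt.not_ge
    · have hsub : {y ∈ S | f y = f x} ⊆ {x} := fun z hz => by
        by_contra hzx
        exact (h z hz.1 hzx).ne hz.2
      simpa using convexHull_mono hsub hmem
  refine ⟨subset_convexHull ℚ S hx, fun y hy z hz hseg => ?_⟩
  obtain ⟨a, b, ha, hb, hab, hxe⟩ := hseg
  refine huniq y hy (le_of_mul_le_mul_left ?_ ha)
  have h₁ := congrArg f hxe
  simp only [map_add, map_smul, smul_eq_mul] at h₁
  have h₂ := mul_le_mul_of_nonneg_left (le_of_mem_convexHull f hle hz) hb.le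
  have h₃ : a * f x + b * f x = f x := by rw [← add_mul, hab, one_mul]
  linarith

end ConvexHull

namespace DelPezzo

/-! ### Conic classes give crosspolytope faces -/

section Rational

variable {r : ℕ}

theorem inter_toQ (x y : Pic r) : inter (toQ x) (toQ y) = ((inter x y : ℤ) : ℚ) := by
  simp [inter, toQ]

theorem toQ_canonical : toQ (canonical : Pic r) = canonical := by
  ext i <;> simp [toQ, canonical_fst, canonical_snd]

theorem toQ_add (x y : Pic r) : toQ (x + y) = toQ x + toQ y := by
  ext i <;> simp [toQ]

theorem toQ_sub (x y : Pic r) : toQ (x - y) = toQ x - toQ y := by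
  ext i <;> simp [toQ]

theorem toQ_injective : Function.Injective (toQ : Pic r → PicQ r) := by
  intro x y h
  ext i
  · simpa [toQ] using congrArg Prod.fst h
  · simpa [toQ] using congrFun (congrArg Prod.snd h) i

theorem inter_toQ_canonical (x : Pic r) :
    inter (toQ x) canonical = ((inter x canonical : ℤ) : ℚ) := by
  rw [← toQ_canonical, inter_toQ]

theorem continuous_inter (y : PicQ r) : Continuous fun x : PicQ r => inter x y := by
  unfold inter
  fun_prop

/-- The convex hull of the lines orthogonal to `D`. -/
def conicFace (D : Pic r) : Set (PicQ r) := convexHull ℚ (toQ '' {l ∈ lines r | inter l D = 0})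

theorem inter_eq_zero_of_mem_conicFace {D : Pic r} {x : PicQ r} (hx : x ∈ conicFace D) :
    inter x (toQ D) = 0 := by
  refine convexHull_min (t := {x | interRight (toQ D) x = 0}) ?_
    (convex_hyperplane (interRight (toQ D)).isLinear 0) hx
  rintro _ ⟨l, ⟨-, hl⟩, rfl⟩
  simp [inter_toQ, hl]

theorem isExposed_conicFace (hr₃ : 3 ≤ r) (hr₈ : r ≤ 8) {D : Pic r} (hD : IsConicClass D) :
    IsExposed ℚ (gossetPolytope r) (conicFace D) := by
  rintro -
  have hle : ∀ x ∈ gossetPolytope r, interRight (-toQ D) x ≤ 0 := by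
    intro x hx
    refine le_of_mem_convexHull _ ?_ hx
    rintro _ ⟨l, hl, rfl⟩
    have := hD.inter_line_nonneg hr₈ hl
    rw [interRight_apply, ← neg_one_smul ℚ, inter_smul_right, inter_toQ]
    simpa using this
  have hneg (x : PicQ r) : interRight (-toQ D) x = - inter x (toQ D) := by
    rw [interRight_apply, ← neg_one_smul ℚ, inter_smul_right, neg_one_mul]
  have hsub : conicFace D ⊆ gossetPolytope r :=
    convexHull_mono (Set.image_mono fun l hl => hl.1)
  refine ⟨⟨interRight (-toQ D), continuous_inter _⟩, Set.Subset.antisymm ?_ ?_⟩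
  · intro x hx
    refine ⟨hsub hx, fun y hy => (hle y hy).trans_eq ?_⟩
    change 0 = interRight (-toQ D) x
    rw [hneg, inter_eq_zero_of_mem_conicFace hx, neg_zero]
  · rintro x ⟨hx, hmax⟩
    -- A line orthogonal to `D` shows that the bound 0 is attained.
    obtain ⟨l, hl, hlD, -⟩ := hD.exists_disjoint_lines hr₃ hr₈
    have h₀ : 0 ≤ interRight (-toQ D) x := by
      have h := hmax (toQ (l ⟨0, by omega⟩)) (subset_convexHull ℚ _ ⟨_, hl _, rfl⟩)
      change interRight (-toQ D) _ ≤ interRight (-toQ D) x at h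
      rwa [hneg, inter_toQ, hlD, Int.cast_zero, neg_zero] at h
    rcases mem_convexHull_sep_of_le (interRight (-toQ D)) (M := 0)
      (fun y hy => hle y (subset_convexHull ℚ _ hy)) hx with h | h
    · exact absurd h₀ h.not_ge
    · refine convexHull_mono ?_ h
      rintro _ ⟨⟨m, hm, rfl⟩, hm₀⟩
      refine ⟨m, ⟨hm, ?_⟩, rfl⟩
      rw [hneg, inter_toQ] at hm₀
      simpa using hm₀

theorem conicFace_eq (hr₃ : 3 ≤ r) (hr₈ : r ≤ 8) {D : Pic r} (hD : IsConicClass D)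
    {l : Fin (r - 1) → Pic r} (hl : ∀ i, l i ∈ lines r) (hlD : ∀ i, inter (l i) D = 0)
    (hll : ∀ i j, i ≠ j → inter (l i) (l j) = 0) :
    conicFace D = convexHull ℚ
      (Set.range (fun i => toQ (l i)) ∪ Set.range (fun i => toQ (D - l i))) := by
  refine congrArg (convexHull ℚ) (Set.Subset.antisymm ?_ ?_)
  · rintro _ ⟨m, ⟨hm, hmD⟩, rfl⟩
    obtain ⟨i, rfl | rfl⟩ := eq_or_eq_sub_of_inter_eq_zero hr₃ hr₈ hD hl hlD hll hm hmD
    · exact Or.inl ⟨i, rfl⟩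
    · exact Or.inr ⟨i, rfl⟩
  · rintro _ (⟨i, rfl⟩ | ⟨i, rfl⟩)
    · exact ⟨_, ⟨hl i, hlD i⟩, rfl⟩
    · exact ⟨_, ⟨hD.sub_mem_lines (hl i) (hlD i), by rw [inter_sub_left, hD.1, hlD, sub_zero]⟩,
        rfl⟩

theorem isCrosspolytopeWithCenter_conicFace (hr₃ : 3 ≤ r) (hr₈ : r ≤ 8) {D : Pic r}
    (hD : IsConicClass D) : IsCrosspolytopeWithCenter r (conicFace D) (toQ D) := by
  obtain ⟨l, hl, hlD, hll⟩ := hD.exists_disjoint_lines hr₃ hr₈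
  refine ⟨isExposed_conicFace hr₃ hr₈ hD, (1 / 2 : ℚ) • toQ D, ⟨?_, ?_⟩, by module⟩
  · simp [hyperplane, inter_smul_left, inter_toQ_canonical, hD.2]
  refine ⟨fun i => toQ (l i) - (1 / 2 : ℚ) • toQ D, 1, one_pos, fun i => ?_, fun i j => ?_, ?_⟩
  · simp [hyperplane, inter_sub_left, inter_smul_left, inter_toQ_canonical, hD.2, (hl i).2]
  · have h : inter (l i) (l j) = if i = j then -1 else 0 := by
      split_ifs with hij
      · rw [hij, (hl j).1]
      · exact hll i j hij
    simp only [inter_sub_left, inter_sub_right, inter_smul_left, inter_smul_right, inter_toQ,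
      inter_comm D (l _), hlD, hD.1, h]
    split_ifs <;> simp
  · rw [conicFace_eq hr₃ hr₈ hD hl hlD hll]
    congr 4
    · ext1 i
      module
    · ext1 i
      rw [toQ_sub]
      module

/-- Some `l` and `D - l` both lie in the common face, so `D · D' = 0`; then `D - D'` is an isotropic
vector of `K^⊥`. -/
theorem eq_of_conicFace_eq (hr₃ : 3 ≤ r) (hr₈ : r ≤ 8) {D D' : Pic r} (hD : IsConicClass D)
    (hD' : IsConicClass D') (h : conicFace D = conicFace D') : D = D' := by
  obtain ⟨l, hl, hlD, -⟩ := hD.exists_disjoint_lines hr₃ hr₈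
  have key (m : Pic r) (hm : m ∈ lines r) (hmD : inter m D = 0) : inter m D' = 0 := by
    have h₁ : toQ m ∈ conicFace D' := h ▸ subset_convexHull ℚ _ ⟨m, ⟨hm, hmD⟩, rfl⟩
    have h₂ := inter_eq_zero_of_mem_conicFace h₁
    rw [inter_toQ] at h₂
    exact_mod_cast h₂
  let i : Fin (r - 1) := ⟨0, by omega⟩
  have h₁ := key _ (hl i) (hlD i)
  have h₂ := key _ (hD.sub_mem_lines (hl i) (hlD i)) (by
    rw [inter_sub_left, hD.1, hlD, sub_zero])
  rw [inter_sub_left, h₁, sub_zero] at h₂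
  refine sub_eq_zero.1 (eq_zero_of_inter_self hr₈ ?_ ?_)
  · rw [inter_sub_left, hD.2, hD'.2, sub_self]
  · rw [inter_sub_left, inter_sub_right, inter_sub_right, hD.1, hD'.1, inter_comm D' D, h₂]
    rfl

/-! ### Every crosspolytope face comes from a conic class -/

/-- The vertices of a crosspolytope that is a face of the Gosset polytope are lines. -/
theorem exists_lines_of_isExposed {n : ℕ} {F : Set (PicQ r)} {c : PicQ r}
    (hF : IsExposed ℚ (gossetPolytope r) F) {v : Fin n → PicQ r} {ρ : ℚ} (hρ : 0 < ρ)
    (hv : ∀ i j, -inter (v i) (v j) = if i = j then ρ else 0)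
    (hFv : F = convexHull ℚ (Set.range (fun i => c + v i) ∪ Set.range (fun i => c - v i)))
    (i : Fin n) : (∃ l ∈ lines r, toQ l = c + v i) ∧ ∃ l ∈ lines r, toQ l = c - v i := by
  have hext : F.extremePoints ℚ ⊆ toQ '' lines r :=
    hF.isExtreme.extremePoints_subset_extremePoints.trans extremePoints_convexHull_subset
  have hv' (i j) : inter (v i) (v j) = if i = j then -ρ else 0 := by
    have := hv i j
    split_ifs at this ⊢ <;> linarith
  constructor
  · refine hext ?_
    rw [hFv]
    -- Relative to its value at `c`, this functional is `ρ` at `c + vᵢ`, `-ρ` at `c - vᵢ` and 0 at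
    -- the other vertices.
    refine mem_extremePoints_convexHull_of_forall_lt (-interRight (v i)) (Or.inl ⟨i, rfl⟩) ?_
    rintro _ (⟨j, rfl⟩ | ⟨j, rfl⟩) hne <;>
    simp only [LinearMap.neg_apply, interRight_apply, inter_add_left, inter_sub_left, hv'] <;>
    split_ifs with hji <;>
    first | linarith | exact absurd (hji ▸ rfl) hne
  · refine hext ?_
    rw [hFv]
    refine mem_extremePoints_convexHull_of_forall_lt (interRight (v i)) (Or.inr ⟨i, rfl⟩) ?_
    rintro _ (⟨j, rfl⟩ | ⟨j, rfl⟩) hne <;>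
    simp only [interRight_apply, inter_add_left, inter_sub_left, hv'] <;>
    split_ifs with hji <;>
    first | linarith | exact absurd (hji ▸ rfl) hne

/-- The product of two lines `p`, `q` is at most `3`, and if it is `3` then `p + q = -2K`. -/
theorem inter_lines_le (hr₈ : r ≤ 8) {p q : Pic r} (hp : p ∈ lines r) (hq : q ∈ lines r) :
    inter p q ≤ 3 ∧ (inter p q = 3 → p + q = (-2 : ℤ) • canonical) := by
  obtain ⟨hpp, hpK⟩ := hp
  obtain ⟨hqq, hqK⟩ := hq
  have hk : (1 : ℤ) ≤ 9 - r := by omega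
  obtain ⟨k, hkr⟩ : ∃ k : ℤ, k = 9 - r := ⟨_, rfl⟩
  rw [← hkr] at hk
  have hK : inter (canonical : Pic r) canonical = k := by rw [inter_canonical_canonical, hkr]
  -- With `k = K²`, this is `k` times the projection of `p + q` to `K^⊥`. Its square gives `p · q ≤
  -- 1 + 2 / k`, so the value 3 needs `k = 1` and a zero projection.
  have hxK : inter (k • (p + q) + (2 : ℤ) • canonical) canonical = 0 := by
    simp only [inter_add_left, inter_smul_left, hK, hpK, hqK]; ring
  have hxx : inter (k • (p + q) + (2 : ℤ) • canonical) (k • (p + q) + (2 : ℤ) • canonical) =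
      k * (k * (2 * inter p q - 2) - 4) := by
    simp only [inter_add_left, inter_add_right, inter_smul_left, inter_smul_right, hK, hpK, hqK,
      inter_comm canonical p, inter_comm canonical q, inter_comm q p, hpp, hqq]
    ring
  have h₁ := inter_self_nonpos hr₈ hxK
  rw [hxx] at h₁
  have h₂ : k * (2 * inter p q - 2) - 4 ≤ 0 := nonpos_of_mul_nonpos_right h₁ (by omega)
  refine ⟨by nlinarith, fun h₃ => ?_⟩
  have hk₁ : k = 1 := by rw [h₃] at h₂; omega
  have h₀ := eq_zero_of_inter_self hr₈ hxK (by rw [hxx, h₃, hk₁]; norm_num)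
  rw [hk₁, one_smul] at h₀
  rw [eq_neg_of_add_eq_zero_left h₀, neg_smul]

/-- An exposed face containing `-K` contains all lines if the lines are symmetric about `-K`. -/
theorem toQ_mem_of_neg_canonical_mem (hr : r = 8) {F : Set (PicQ r)}
    (hF : IsExposed ℚ (gossetPolytope r) F) (hK : -canonical ∈ F) {l : Pic r}
    (hl : l ∈ lines r) : toQ l ∈ F := by
  obtain ⟨f, rfl⟩ := hF ⟨_, hK⟩
  have hKK : inter (canonical : Pic r) canonical = 1 := by
    rw [inter_canonical_canonical, hr]; norm_num
  -- `-K` is the midpoint of `l` and this line, so a functional maximal at `-K` is maximal at `l`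
  -- too.
  have hl' : (-2 : ℤ) • canonical - l ∈ lines r := by
    obtain ⟨hll, hlK⟩ := hl
    constructor <;>
    simp only [inter_sub_left, inter_sub_right, inter_smul_left, inter_smul_right, hKK,
      inter_comm canonical l, hll, hlK] <;> norm_num
  have h₁ := hK.2 _ (subset_convexHull ℚ _ ⟨_, hl', rfl⟩)
  have h₂ : toQ ((-2 : ℤ) • canonical - l) = (2 : ℚ) • (-canonical) - toQ l := by
    rw [toQ_sub, ← toQ_canonical]
    ext i <;> simp [toQ]
  rw [h₂, map_sub, map_smul, smul_eq_mul] at h₁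
  refine ⟨subset_convexHull ℚ _ ⟨_, hl, rfl⟩, fun y hy => (hK.2 y hy).trans ?_⟩
  linarith

theorem IsCrosspolytopeWithCenter.exists_conicClass (hr₃ : 3 ≤ r) (hr₈ : r ≤ 8)
    {F : Set (PicQ r)} {D : PicQ r} (h : IsCrosspolytopeWithCenter r F D) :
    ∃ D' ∈ linePairSums r, D = toQ D' ∧ F = conicFace D' := by
  obtain ⟨hF, c, ⟨-, v, ρ, hρ, -, hv, hFv⟩, rfl⟩ := h
  choose p hp hpv using fun i => (exists_lines_of_isExposed hF hρ hv hFv i).1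
  choose q hq hqv using fun i => (exists_lines_of_isExposed hF hρ hv hFv i).2
  let i₀ : Fin (r - 1) := ⟨0, by omega⟩
  obtain ⟨D, hDe⟩ : ∃ D, D = p i₀ + q i₀ := ⟨_, rfl⟩
  have hDc : toQ D = (2 : ℚ) • c := by
    rw [hDe, toQ_add, hpv, hqv]
    module
  have hq' (i) : q i = D - p i := by
    apply toQ_injective
    rw [toQ_sub, hDc, hpv, hqv]
    module
  have hDK : inter D canonical = -2 := by rw [hDe, inter_add_left, (hp _).2, (hq _).2]; rfl
  have hpD (i) : 2 * inter (p i) D = inter D D := by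
    have h₁ := (hq i).1
    rw [hq', inter_sub_left, inter_sub_right, inter_sub_right, (hp i).1,
      inter_comm D (p i)] at h₁
    omega
  have hpp (i j) (hij : i ≠ j) : 4 * inter (p i) (p j) = inter D D := by
    have h₁ := hv i j
    rw [if_neg hij] at h₁
    have h₂ (i) : v i = toQ (p i) - (1 / 2 : ℚ) • toQ D := by
      rw [hDc, hpv]
      module
    have h₃ : 2 * ((inter (p i) D : ℤ) : ℚ) = ((inter D D : ℤ) : ℚ) := by exact_mod_cast hpD i
    have h₄ : 2 * ((inter (p j) D : ℤ) : ℚ) = ((inter D D : ℤ) : ℚ) := by exact_mod_cast hpD j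
    simp only [h₂, inter_sub_left, inter_sub_right, inter_smul_left, inter_smul_right, inter_toQ,
      inter_comm D (p j)] at h₁
    have : 4 * ((inter (p i) (p j) : ℤ) : ℚ) = ((inter D D : ℤ) : ℚ) := by linarith
    exact_mod_cast this
  have hpq : 2 * inter (p i₀) (q i₀) = inter D D + 2 := by
    rw [hq', inter_sub_right, (hp _).1, mul_sub, hpD]; ring
  have hne : p i₀ ≠ q i₀ := by
    intro h₀
    have h₁ : v i₀ = 0 := by
      have h₂ : c + v i₀ = c - v i₀ := by rw [← hpv, ← hqv, h₀]
      have h₃ : (2 : ℚ) • v i₀ = 0 := by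
        rw [two_smul, ← sub_eq_zero.2 h₂]
        abel
      simpa using h₃
    have h₂ := hv i₀ i₀
    rw [h₁, if_pos rfl] at h₂
    simp [inter] at h₂
    exact hρ.ne h₂
  have hnn := inter_lines_nonneg hr₈ (hp i₀) (hq i₀) hne
  obtain ⟨hle, heq3⟩ := inter_lines_le hr₈ (hp i₀) (hq i₀)
  -- A second axis exists because `r ≥ 3`; it gives `4 ∣ D²`.
  have hpp₀ := hpp i₀ ⟨1, by omega⟩ (by simp [i₀, Fin.ext_iff])
  have hcF : c ∈ F := by
    rw [hFv]
    have h₁ := convex_convexHull ℚ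
      (Set.range (fun i => c + v i) ∪ Set.range (fun i => c - v i))
      (subset_convexHull ℚ _ (Or.inl ⟨i₀, rfl⟩)) (subset_convexHull ℚ _ (Or.inr ⟨i₀, rfl⟩))
      (show (0 : ℚ) ≤ 1 / 2 by norm_num) (show (0 : ℚ) ≤ 1 / 2 by norm_num) (by norm_num)
    convert h₁ using 1
    module
  have hne3 : inter (p i₀) (q i₀) ≠ 3 := by
    intro h₃
    have hD2 := heq3 h₃
    rw [← hDe] at hD2
    have hr : r = 8 := by
      have h₁ := hDK
      rw [hD2, inter_smul_left, inter_canonical_canonical] at h₁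
      omega
    have hcK : c = -canonical := by
      have h₁ : (2 : ℚ) • c = (2 : ℚ) • (-canonical) := by
        rw [← hDc, hD2, ← toQ_canonical]
        ext i <;> simp [toQ]
      exact smul_right_injective _ (two_ne_zero' ℚ) h₁
    have hall (l) (hl : l ∈ lines r) : ∃ i, l = p i ∨ l = q i := by
      have h₁ := toQ_mem_of_neg_canonical_mem hr hF (hcK ▸ hcF) hl
      rw [hFv] at h₁
      by_contra! hlne
      -- If `l` is not a vertex, `x ↦ -x · l` is nonpositive on all vertices, yet it is 1 at `l`.
      have h₂ := le_of_mem_convexHull (-interRight (toQ l)) (M := 0) (by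
        rintro _ (⟨i, rfl⟩ | ⟨i, rfl⟩)
        · dsimp only
          rw [← hpv, LinearMap.neg_apply, interRight_apply, inter_toQ, neg_nonpos]
          exact_mod_cast inter_lines_nonneg hr₈ (hp i) hl (hlne i).1.symm
        · dsimp only
          rw [← hqv, LinearMap.neg_apply, interRight_apply, inter_toQ, neg_nonpos]
          exact_mod_cast inter_lines_nonneg hr₈ (hq i) hl (hlne i).2.symm) h₁
      rw [LinearMap.neg_apply, interRight_apply, inter_toQ, hl.1] at h₂
      norm_num at h₂
    have hDD : inter D D = 4 := by omega
    have hpp' (i j) : inter (p i) (p j) = 1 ∨ inter (p i) (p j) = -1 := by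
      by_cases hij : i = j
      · exact Or.inr (hij ▸ (hp i).1)
      · exact Or.inl (by have := hpp i j hij; omega)
    -- When `D² = 4`, any two vertices have odd product, but two exceptional classes have product 0.
    have he : inter (eClass ⟨0, by omega⟩ : Pic r) (eClass ⟨1, by omega⟩) = 0 := by
      simp [inter_eClass_eClass]
    obtain ⟨i, hi⟩ := hall _ (eClass_mem_lines ⟨0, by omega⟩)
    obtain ⟨j, hj⟩ := hall _ (eClass_mem_lines ⟨1, by omega⟩)
    have h₁ := hpD i
    have h₂ := hpD j
    have h₄ := hpp' i j
    rcases hi with hi | hi <;> rcases hj with hj | hj <;>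
    simp only [hi, hj, hq', inter_sub_left, inter_sub_right, inter_comm D (p j)] at he <;>
    omega
  -- Now `0 ≤ p · q ≤ 2`, so `D²` lies between -2 and 2 and is a multiple of 4.
  have hD0 : inter D D = 0 := by omega
  have hD : IsConicClass D := ⟨hD0, hDK⟩
  refine ⟨D, ⟨_, hp i₀, _, hq i₀, by omega, hDe⟩, hDc.symm, ?_⟩
  rw [conicFace_eq hr₃ hr₈ hD hp (fun i => by have := hpD i; omega)
    (fun i j hij => by have := hpp i j hij; omega), hFv]
  simp only [← hq', hpv, hqv]

end Rational

end DelPezzo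

theorem mainTheorem4 (r : ℕ) (hr₃ : 3 ≤ r) (hr₈ : r ≤ 8) :
    (DelPezzo.toQ '' DelPezzo.linePairSums r =
      {D : DelPezzo.PicQ r | ∃ F : Set (DelPezzo.PicQ r),
        DelPezzo.IsCrosspolytopeWithCenter r F D}) ∧
    (∀ D ∈ DelPezzo.linePairSums r,
      ∃! F : Set (DelPezzo.PicQ r), DelPezzo.IsCrosspolytopeWithCenter r F (DelPezzo.toQ D)) ∧
    (∀ (F : Set (DelPezzo.PicQ r)) (D D' : DelPezzo.PicQ r),
      DelPezzo.IsCrosspolytopeWithCenter r F D →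
      DelPezzo.IsCrosspolytopeWithCenter r F D' → D = D') := by
  refine ⟨Set.Subset.antisymm ?_ ?_, fun D hD => ?_, fun F D D' h h' => ?_⟩
  · rintro _ ⟨D, hD, rfl⟩
    exact ⟨_, DelPezzo.isCrosspolytopeWithCenter_conicFace hr₃ hr₈ (DelPezzo.isConicClass_of_mem_linePairSums hD)⟩
  · rintro D ⟨F, hF⟩
    obtain ⟨D', hD', rfl, -⟩ := hF.exists_conicClass hr₃ hr₈
    exact ⟨D', hD', rfl⟩
  · refine ⟨DelPezzo.conicFace D, DelPezzo.isCrosspolytopeWithCenter_conicFace hr₃ hr₈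
      (DelPezzo.isConicClass_of_mem_linePairSums hD), fun F hF => ?_⟩
    obtain ⟨D', -, hDD', rfl⟩ := hF.exists_conicClass hr₃ hr₈
    rw [DelPezzo.toQ_injective hDD']
  · obtain ⟨D, hD, rfl, hFD⟩ := h.exists_conicClass hr₃ hr₈
    obtain ⟨D', hD', rfl, hFD'⟩ := h'.exists_conicClass hr₃ hr₈
    rw [DelPezzo.eq_of_conicFace_eq hr₃ hr₈ (DelPezzo.isConicClass_of_mem_linePairSums hD)
      (DelPezzo.isConicClass_of_mem_linePairSums hD') (hFD.symm.trans hFD')]
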